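/- A structured matrix $[H]\in\{0,*\}^{m\times n}$ has entries that are either fixed zeros or free parameters $*$; a real matrix is an admissible numerical realization of $[H]$ if it vanishes at all fixed zeros of $[H]$ (free parameters may take any real value, including $0$). A pair $([A],[B])$ of structured matrices, of sizes $n\times n$ and $n\times p$, is \emph{structurally controllable} if it has an admissible numerical realization $(A,B)$ for which the system $\dot x=Ax+Bu$ is controllable, that is, every initial state can be transferred to every final state in finite time by some (continuous) input. Let $[A]\in\{0,*\}^{n\times n}$, $[B_{def}]\in\{0,*\}^{n\times d}$ and $[K_{def}]\in\{0,*\}^{d\times n}$ be structured matrices, and let $[A_{def}]=[A]+[B_{def}][K_{def}]$ be the structured matrix whose entry $(i,j)$ is free if and only if $[A]_{ij}=*$ or $[B_{def}]_{ik}=[K_{def}]_{kj}=*$ for some $k$. Let $\mathcal{X}=\{x_1,\dots,x_n\}$ be the set of states and $\mathcal{X}_{def}=\{x_i : [B_{def}]_{ik}=* \text{ for some } k\}$. For $[B_{att}]\in\{0,*\}^{n\times a}$ put likewise $\mathcal{X}_{att}=\{x_i : [B_{att}]_{ik}=*\text{ for some }k\}$. Under an integrity attack the system is $$\dot x=[A_{def}]x+[B_{att}]u_{att},$$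 where the attacker may choose finitely many inputs and connect them to any states outside $\mathcal{X}_{def}$, so that $\mathcal{X}_{att}\cap\mathcal{X}_{def}=\emptyset$. The system is \emph{structurally resilient to an integrity attack} if the attacker cannot achieve structural controllability, i.e. if there are no $a$ and no $[B_{att}]\in\{0,*\}^{n\times a}$ with $\mathcal{X}_{att}\cap\mathcal{X}_{def}=\emptyset$ for which $([A_{def}],[B_{att}])$ is structurally controllable. Let $\mathcal{D}([A_{def}])$ be the directed graph on $\mathcal{X}$ with an edge $x_j\to x_i$ whenever $[A_{def}]_{ij}=*$, and let $\mathcal{B}([A_{def}])$ be the bipartite graph with a left and a right copy of $\mathcal{X}$ and an edge from the left copy of $x_j$ to the right copy of $x_i$ whenever $[A_{def}]_{ij}=*$. A maximum matching is a set of pairwise vertex-disjoint edges of $\mathcal{B}([A_{def}])$ of largest cardinality; a state is right unmatched if its right copy lies on no edge of the matching. A strongly connected component (SCC) is non-top-linked if no edge enters it from a vertex outside it. \textbf{Theorem.} The system is structurally resilient to an integrity attack if and only if at least one of the following holds: (i) every maximum matching of $\mathcal{B}([A_{def}])$ has a right unmatched vertex in $\mathcal{X}_{def}$; (ii) some non-top-linked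 SCC of $\mathcal{D}([A_{def}])$ consists only of vertices of $\mathcal{X}_{def}$. -/

import Mathlib

namespace StructuredSystem

open Matrix

/-! ### Structured matrices -/

/-- A structured matrix, an element of `{0, *}^(m × n)`: the entry `(i, j)` is a free
parameter `*` if `H i j` holds, and a fixed zero otherwise. -/
abbrev StructMatrix (m n : ℕ) : Type := Matrix (Fin m) (Fin n) Prop

/-- A real matrix is an admissible numerical realization of `[H]` if it vanishes at every fixed
zero of `[H]`; the free parameters may take any value, including `0`. -/
def IsRealization {m n : ℕ} (H : StructMatrix m n) (M : Matrix (Fin m) (Fin n) ℝ) : Prop :=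
  ∀ i j, ¬ H i j → M i j = 0

/-- The structured matrix `[A] + [B][K]`, with the usual rules for `0` and `*`
(`* + * = * + 0 = *`, `* · * = *`, `* · 0 = 0`). -/
def closedLoop {n d : ℕ} (A : StructMatrix n n) (B : StructMatrix n d) (K : StructMatrix d n) :
    StructMatrix n n :=
  fun i j => A i j ∨ ∃ k, B i k ∧ K k j

/-- The set of states to which some input of the structured input matrix `[B]` is connected. -/
def inputStates {n p : ℕ} (B : StructMatrix n p) : Set (Fin n) :=
  {i | ∃ j, B i j}

/-! ### Controllability -/

/-- The continuous input `u` steers `ẋ = A x + B u` from `x₀` at time `0` to `x₁` at time `T`. -/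
def Steers {n p : ℕ} (A : Matrix (Fin n) (Fin n) ℝ) (B : Matrix (Fin n) (Fin p) ℝ)
    (T : ℝ) (u : ℝ → Fin p → ℝ) (x₀ x₁ : Fin n → ℝ) : Prop :=
  ContinuousOn u (Set.Icc 0 T) ∧
    ∃ x : ℝ → Fin n → ℝ, x 0 = x₀ ∧ x T = x₁ ∧
      ∀ t ∈ Set.Icc 0 T, HasDerivWithinAt x (A *ᵥ x t + B *ᵥ u t) (Set.Icc 0 T) t

/-- The system `ẋ = A x + B u` is controllable: every initial state can be transferred to every
final state in finite time by some input. -/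
def Controllable {n p : ℕ} (A : Matrix (Fin n) (Fin n) ℝ) (B : Matrix (Fin n) (Fin p) ℝ) : Prop :=
  ∀ x₀ x₁ : Fin n → ℝ, ∃ T : ℝ, 0 < T ∧ ∃ u : ℝ → Fin p → ℝ, Steers A B T u x₀ x₁

/-- `([A], [B])` is structurally controllable: some admissible numerical realization is
controllable. -/
def StructurallyControllable {n p : ℕ} (A : StructMatrix n n) (B : StructMatrix n p) : Prop :=
  ∃ (A' : Matrix (Fin n) (Fin n) ℝ) (B' : Matrix (Fin n) (Fin p) ℝ),
    IsRealization A A' ∧ IsRealization B B' ∧ Controllable A' B'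

/-! ### Integrity attacks -/

/-- The attack on `ẋ = [A_def] x + [B_att] u_att`, `[A_def] = [A] + [B_def][K_def]`, succeeds:
the attacker can connect some finite number of inputs to states, none of them in
`X_def = inputStates Bdef`, so that the system becomes structurally controllable. -/
def IntegrityAttackSucceeds {n d : ℕ} (A : StructMatrix n n) (Bdef : StructMatrix n d)
    (Kdef : StructMatrix d n) : Prop :=
  ∃ (a : ℕ) (Batt : StructMatrix n a),
    Disjoint (inputStates Bdef) (inputStates Batt) ∧
      StructurallyControllable (closedLoop A Bdef Kdef) Batt

/-- Structural resilience to an integrity attack: the attacker cannot achieve structural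
controllability without connecting inputs to `X_def`. -/
def ResilientToIntegrityAttack {n d : ℕ} (A : StructMatrix n n) (Bdef : StructMatrix n d)
    (Kdef : StructMatrix d n) : Prop :=
  ¬ IntegrityAttackSucceeds A Bdef Kdef

/-! ### The bipartite graph of a structured matrix and its matchings -/

/-- A matching in the bipartite graph of `[A]`. The pair `(j, i)` stands for the edge from the left
copy of the state `j` to the right copy of the state `i`, present if `[A]_{ij} ≠ 0`. Distinct
edges of a matching share neither their left nor their right vertex. -/
def IsMatching {n : ℕ} (A : StructMatrix n n) (M : Finset (Fin n × Fin n)) : Prop :=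
  (∀ e ∈ M, A e.2 e.1) ∧
    ∀ e ∈ M, ∀ f ∈ M, e ≠ f → e.1 ≠ f.1 ∧ e.2 ≠ f.2

/-- A maximum matching: one with the largest number of edges. -/
def IsMaximumMatching {n : ℕ} (A : StructMatrix n n) (M : Finset (Fin n × Fin n)) : Prop :=
  IsMatching A M ∧ ∀ N : Finset (Fin n × Fin n), IsMatching A N → N.card ≤ M.card

/-- The right copy of the state `i` belongs to no edge of `M`. -/
def RightUnmatched {n : ℕ} (M : Finset (Fin n × Fin n)) (i : Fin n) : Prop :=
  ∀ e ∈ M, e.2 ≠ i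

/-! ### The directed graph of a structured matrix and its strongly connected components -/

/-- The directed graph of `[A]` on the states: there is an edge `j → i` if `[A]_{ij} ≠ 0`. -/
def digraph {n : ℕ} (A : StructMatrix n n) : Digraph (Fin n) where
  Adj j i := A i j

/-- The subgraph induced on the nonempty vertex set `S` is strongly connected: there is a directed
path inside `S` from each vertex of `S` to every other. -/
def StronglyConnectedOn {V : Type*} (D : Digraph V) (S : Set V) : Prop :=
  S.Nonempty ∧
    ∀ v ∈ S, ∀ w ∈ S, Relation.ReflTransGen (fun a b => a ∈ S ∧ b ∈ S ∧ D.Adj a b) v w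

/-- `S` is the vertex set of a strongly connected component, i.e. of a maximal strongly connected
subgraph. -/
def IsSCC {V : Type*} (D : Digraph V) (S : Set V) : Prop :=
  Maximal (StronglyConnectedOn D) S

/-- A strongly connected component without incoming edges from outside. -/
def IsNonTopLinkedSCC {V : Type*} (D : Digraph V) (S : Set V) : Prop :=
  IsSCC D S ∧ ∀ v w, v ∉ S → w ∈ S → ¬ D.Adj v w

end StructuredSystem

namespace StructuredSystem

open Matrix

/-! Resilience is shown by one principle: for a controllable pair, an `A`-invariant subspace
containing the range of `B` is the whole space (`Controllable.eq_top_of_invariant`). Let `D` be the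
set of defended states, on which the rows of `B` vanish. Applied to `range A + range B`, the
principle makes the rows of `A` in `D` independent; Hall's theorem then gives them distinct
in-neighbours, and an exchange argument turns these into a maximum matching covering `D`. Applied to
the vectors vanishing on a non-top-linked SCC inside `D`, it gives a contradiction.

If both conditions fail, a controllable realization is built. A matching covering `D` extends to a
permutation `σ`, and every state is reachable from outside `D`. The cycles of `σ` get distinct
positive weights, and each cycle without a state at distance `0` is linked by one unit entry to a
cycle nearer the complement of `D`, so the cycles form a forest. By the Hautus criterion it suffices
that a left eigenvector `w` vanishing off `D` is zero (`eq_zero_of_cycle_forest`). In the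
eigenvector equation children feed into parents. A deepest cycle carrying `w` receives nothing, so
`|μ|` equals its weight; as the weights differ, `w` lives on a single branch of the forest. Along
this branch each link forces `w` to be nonzero on the whole parent cycle, up to the root, which has
a state outside `D`. -/

/-! ### Controllability and invariant subspaces -/

/-- A subspace which is invariant under `A` and contains the range of `B` contains every state that
can be reached from the origin. -/
theorem Controllable.eq_top_of_invariant {n p : ℕ} {A : Matrix (Fin n) (Fin n) ℝ}
    {B : Matrix (Fin n) (Fin p) ℝ} (h : Controllable A B) (V : Submodule ℝ (Fin n → ℝ))
    (hA : ∀ x ∈ V, A *ᵥ x ∈ V) (hB : ∀ u, B *ᵥ u ∈ V) : V = ⊤ := by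
  obtain ⟨W, hVW⟩ := V.exists_isCompl
  let P : (Fin n → ℝ) →ₗ[ℝ] (Fin n → ℝ) := W.projection V hVW.symm
  have hker : ∀ x, P x = 0 ↔ x ∈ V := fun x => by
    rw [← LinearMap.mem_ker, Submodule.ker_projection]
  have hidem : ∀ x, P (P x) = P x := fun x =>
    Submodule.projection_apply_of_mem_left hVW.symm (Submodule.projection_apply_mem hVW.symm x)
  -- Modulo `V` the input disappears: `P x` solves the autonomous linear equation `ż = P A z` with
  -- `z 0 = 0`, hence is zero by uniqueness.
  have hPA : ∀ x, P (A *ᵥ x) = P (A *ᵥ P x) := fun x => by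
    rw [← sub_eq_zero, ← map_sub, ← Matrix.mulVec_sub, hker]
    exact hA _ ((hker _).1 (by rw [map_sub, hidem, sub_self]))
  let F : (Fin n → ℝ) →L[ℝ] (Fin n → ℝ) := LinearMap.toContinuousLinearMap (P ∘ₗ A.mulVecLin)
  let Q : (Fin n → ℝ) →L[ℝ] (Fin n → ℝ) := LinearMap.toContinuousLinearMap P
  refine eq_top_iff.2 fun x₁ _ => (hker x₁).1 ?_
  obtain ⟨T, hT, u, -, x, h0, h1, hx⟩ := h 0 x₁
  have hd : ∀ t ∈ Set.Icc 0 T,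
      HasDerivWithinAt (fun t => P (x t)) (F (P (x t))) (Set.Icc 0 T) t := fun t ht => by
    have := Q.hasFDerivAt.comp_hasDerivWithinAt t (hx t ht)
    have e : Q (A *ᵥ x t + B *ᵥ u t) = F (P (x t)) := by
      change P _ = P (A *ᵥ P (x t))
      rw [map_add, (hker _).2 (hB _), add_zero, hPA]
    rw [e] at this
    exact this
  have hu : Set.EqOn (fun t => P (x t)) (fun _ => 0) (Set.Icc 0 T) := by
    refine ODE_solution_unique (v := fun _ => F) (K := ‖F‖₊) (fun _ => F.lipschitz)
      (fun t ht => (hd t ht).continuousWithinAt)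
      (fun t ht => (hd t (Set.Ico_subset_Icc_self ht)).mono_of_mem_nhdsWithin
        (Icc_mem_nhdsGE_of_mem ht)) continuousOn_const (fun t _ => ?_) (by simp [h0])
    simpa using hasDerivWithinAt_const t (Set.Ici t) (0 : Fin n → ℝ)
  rw [← h1]
  exact hu (Set.right_mem_Icc.2 hT.le)

/-! ### The Kalman and Hautus criteria -/

/-- The Kalman criterion: a system is controllable if no nonzero functional annihilates all the
vectors `Aᵏ B v`. -/
theorem controllable_of_kalman {n p : ℕ} (A : Matrix (Fin n) (Fin n) ℝ)
    (B : Matrix (Fin n) (Fin p) ℝ)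
    (hK : ∀ φ : (Fin n → ℝ) →ₗ[ℝ] ℝ, (∀ (k : ℕ) v, φ (A ^ k *ᵥ (B *ᵥ v)) = 0) → φ = 0) :
    Controllable A B := by
  let T : (Fin n → ℝ) →L[ℝ] (Fin n → ℝ) := LinearMap.toContinuousLinearMap A.mulVecLin
  let b : (Fin p → ℝ) →L[ℝ] (Fin n → ℝ) := LinearMap.toContinuousLinearMap B.mulVecLin
  let Φ : ℝ → (Fin n → ℝ) →L[ℝ] (Fin n → ℝ) := fun t => NormedSpace.exp (t • T)
  let Ψ : ℝ → (Fin n → ℝ) →L[ℝ] (Fin n → ℝ) := fun t => NormedSpace.exp (t • (-T))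
  have hΦ : ∀ t, HasDerivAt Φ (T * Φ t) t := fun t => hasDerivAt_exp_smul_const' T t
  have hΨ : ∀ t, HasDerivAt Ψ (Ψ t * -T) t := fun t => hasDerivAt_exp_smul_const (-T) t
  have hΨc : Continuous Ψ := continuous_iff_continuousAt.2 fun t => (hΨ t).continuousAt
  let +nondep : NormedAlgebra ℚ ((Fin n → ℝ) →L[ℝ] (Fin n → ℝ)) :=
    NormedAlgebra.restrictScalars ℚ ℝ _
  have hcomm : ∀ t : ℝ, Commute (t • T) (t • (-T)) := fun t => by
    rw [smul_neg]
    exact Commute.neg_right_iff.2 (Commute.refl (t • T))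
  have hΦΨ : ∀ t x, Φ t (Ψ t x) = x := fun t x => by
    have : Φ t * Ψ t = 1 := by
      rw [← NormedSpace.exp_add_of_commute (hcomm t), smul_neg, add_neg_cancel,
        NormedSpace.exp_zero]
    exact congrArg (fun f : (Fin n → ℝ) →L[ℝ] (Fin n → ℝ) => f x) this
  have hΨΦ : ∀ t x, Ψ t (Φ t x) = x := fun t x => by
    have : Ψ t * Φ t = 1 := by
      rw [← NormedSpace.exp_add_of_commute (hcomm t).symm, smul_neg, neg_add_cancel,
        NormedSpace.exp_zero]
    exact congrArg (fun f : (Fin n → ℝ) →L[ℝ] (Fin n → ℝ) => f x) this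
  have hcont : ∀ u : ℝ → Fin p → ℝ, Continuous u → Continuous fun s => Ψ s (b (u s)) :=
    fun u hu => hΨc.clm_apply (b.continuous.comp hu)
  -- By variation of constants, `R` is the set of states reachable from the origin at time `1`,
  -- pulled back by `exp (-A)`.
  let R : Submodule ℝ (Fin n → ℝ) :=
    { carrier := {y | ∃ u : ℝ → Fin p → ℝ, Continuous u ∧ ∫ s in (0 : ℝ)..1, Ψ s (b (u s)) = y}
      zero_mem' := ⟨0, continuous_zero, by simp⟩
      add_mem' := by
        rintro _ _ ⟨u, hu, rfl⟩ ⟨v, hv, rfl⟩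
        refine ⟨u + v, hu.add hv, ?_⟩
        rw [← intervalIntegral.integral_add ((hcont u hu).intervalIntegrable _ _)
          ((hcont v hv).intervalIntegrable _ _)]
        simp
      smul_mem' := by
        rintro c _ ⟨u, hu, rfl⟩
        refine ⟨c • u, hu.const_smul c, ?_⟩
        rw [← intervalIntegral.integral_smul]
        simp }
  have hR : R = ⊤ := by
    by_contra hne
    obtain ⟨φ, hφ, hle⟩ := Submodule.exists_le_ker_of_lt_top R (lt_top_iff_ne_top.2 hne)
    let f : (Fin n → ℝ) →L[ℝ] ℝ := LinearMap.toContinuousLinearMap φ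
    -- With this input, `φ` of the resulting element of `R` is the integral of `|u|²`, so `φ = 0` on
    -- `R` forces `u = 0` on `[0, 1]`.
    let u : ℝ → Fin p → ℝ := fun s j => f (Ψ s (b (Pi.single j 1)))
    have hu : Continuous u := continuous_pi fun j =>
      f.continuous.comp (hΨc.clm_apply continuous_const)
    have hb : ∀ s (v : Fin p → ℝ), f (Ψ s (b v)) = ∑ j, v j * u s j := fun s v => by
      conv_lhs => rw [pi_eq_sum_univ' v]
      simp only [map_sum, map_smul, smul_eq_mul]
      rfl
    have hint : ∫ s in (0 : ℝ)..1, ∑ j, u s j * u s j = 0 := by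
      have h0 : f (∫ s in (0 : ℝ)..1, Ψ s (b (u s))) = 0 := hle ⟨u, hu, rfl⟩
      rw [← f.intervalIntegral_comp_comm ((hcont u hu).intervalIntegrable _ _)] at h0
      simpa only [hb] using h0
    have hu0 : ∀ s ∈ Set.Icc (0 : ℝ) 1, ∀ j, u s j = 0 := by
      intro s hs j
      by_contra hj
      refine (intervalIntegral.integral_pos one_pos ?_ (fun s _ => ?_) ⟨s, hs, ?_⟩).ne' hint
      · fun_prop
      · exact Finset.sum_nonneg fun j _ => mul_self_nonneg _
      · exact Finset.sum_pos' (fun j _ => mul_self_nonneg _)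
          ⟨j, Finset.mem_univ _, mul_self_pos.2 hj⟩
    -- Each differentiation in `s` brings out one factor `-A`; the open interval allows two-sided
    -- derivatives.
    have hk : ∀ (k : ℕ) v, ∀ s ∈ Set.Ioo (0 : ℝ) 1, f (Ψ s (A ^ k *ᵥ (B *ᵥ v))) = 0 := by
      intro k v
      induction k with
      | zero =>
        intro s hs
        have := hb s v
        simp only [hu0 s (Set.Ioo_subset_Icc_self hs), mul_zero, Finset.sum_const_zero] at this
        rw [pow_zero, Matrix.one_mulVec]
        exact this
      | succ k ih =>
        intro s hs
        have hd : HasDerivAt (fun s => f (Ψ s (A ^ k *ᵥ (B *ᵥ v))))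
            (f ((Ψ s * -T) (A ^ k *ᵥ (B *ᵥ v)))) s :=
          f.hasFDerivAt.comp_hasDerivAt s (by simpa using (hΨ s).clm_apply (hasDerivAt_const s (A ^ k *ᵥ (B *ᵥ v))))
        have hz : HasDerivAt (fun s => f (Ψ s (A ^ k *ᵥ (B *ᵥ v)))) 0 s :=
          (hasDerivAt_const s (0 : ℝ)).congr_of_eventuallyEq
            (Filter.eventually_of_mem (isOpen_Ioo.mem_nhds hs) ih)
        have e := hd.unique hz
        have e2 : (Ψ s * -T) (A ^ k *ᵥ (B *ᵥ v)) = -Ψ s (A ^ (k + 1) *ᵥ (B *ᵥ v)) := by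
          rw [pow_succ', ← Matrix.mulVec_mulVec]
          change Ψ s (-(A *ᵥ _)) = _
          rw [map_neg]
        rw [e2, map_neg, neg_eq_zero] at e
        exact e
    have hz := hK (φ ∘ₗ (Ψ (1 / 2) : (Fin n → ℝ) →ₗ[ℝ] (Fin n → ℝ)))
      fun k v => hk k v (1 / 2) (by norm_num)
    refine hφ (LinearMap.ext fun x => ?_)
    have := LinearMap.congr_fun hz (Φ (1 / 2) x)
    simpa [hΨΦ] using this
  intro x₀ x₁
  obtain ⟨u, hu, hux⟩ : Ψ 1 x₁ - x₀ ∈ R := hR ▸ Submodule.mem_top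
  refine ⟨1, one_pos, u, hu.continuousOn,
    fun t => Φ t (x₀ + ∫ s in (0 : ℝ)..t, Ψ s (b (u s))), ?_, ?_, fun t _ => ?_⟩
  · simp [Φ]
  · simp only [hux, add_sub_cancel, hΦΨ]
  · have hi : HasDerivAt (fun t => x₀ + ∫ s in (0 : ℝ)..t, Ψ s (b (u s))) (Ψ t (b (u t))) t :=
      ((hcont u hu).integral_hasStrictDerivAt 0 t).hasDerivAt.const_add x₀
    have := ((hΦ t).clm_apply hi).hasDerivWithinAt (s := Set.Icc 0 1)
    rw [hΦΨ] at this
    exact this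

/-- The Hautus criterion: a system is controllable if no left eigenvector of `A` over the complex
numbers annihilates `B`. -/
theorem controllable_of_hautus {n p : ℕ} (A : Matrix (Fin n) (Fin n) ℝ)
    (B : Matrix (Fin n) (Fin p) ℝ)
    (hH : ∀ (μ : ℂ) (w : Fin n → ℂ), w ᵥ* A.map (algebraMap ℝ ℂ) = μ • w →
      w ᵥ* B.map (algebraMap ℝ ℂ) = 0 → w = 0) :
    Controllable A B := by
  refine controllable_of_kalman A B fun φ hφ => ?_
  set A' := A.map (algebraMap ℝ ℂ) with hA'
  set B' := B.map (algebraMap ℝ ℂ)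
  -- The functionals killing all `Aᵏ B` form an invariant subspace; if nonzero, it contains a
  -- complex eigenvector, which the case `k = 0` shows to annihilate `B`.
  let W : Submodule ℂ (Fin n → ℂ) :=
    { carrier := {w | ∀ k : ℕ, w ᵥ* (A' ^ k * B') = 0}
      zero_mem' := fun k => by simp
      add_mem' := fun {v w} hv hw k => by rw [Matrix.add_vecMul, hv k, hw k, add_zero]
      smul_mem' := fun c w hw k => by rw [Matrix.smul_vecMul, hw k, smul_zero] }
  have hinv : ∀ w ∈ W, A'.vecMulLinear w ∈ W := fun w hw k => by
    rw [Matrix.vecMulLinear_apply, Matrix.vecMul_vecMul, ← Matrix.mul_assoc, ← pow_succ']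
    exact hw (k + 1)
  have hW : W = ⊥ := by
    by_contra hne
    have : Nontrivial W := Submodule.nontrivial_iff_ne_bot.2 hne
    obtain ⟨μ, hμ⟩ := Module.End.exists_eigenvalue (A'.vecMulLinear.restrict hinv)
    obtain ⟨⟨w, hw⟩, hwv⟩ := hμ.exists_hasEigenvector
    refine hwv.2 (Subtype.ext (hH μ w ?_ ?_))
    · exact congrArg Subtype.val hwv.apply_eq_smul
    · simpa using hw 0
  let w : Fin n → ℝ := fun i => φ (Pi.single i 1)
  have hφw : ∀ x, φ x = w ⬝ᵥ x := fun x => by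
    conv_lhs => rw [pi_eq_sum_univ' x]
    simp only [map_sum, map_smul, smul_eq_mul, dotProduct]
    refine Finset.sum_congr rfl fun j _ => ?_
    rw [mul_comm]
  have hw : (fun i => (w i : ℂ)) ∈ W := by
    intro k
    have h1 : w ᵥ* (A ^ k * B) = 0 := by
      refine dotProduct_eq_zero _ fun v => ?_
      rw [← Matrix.dotProduct_mulVec, ← Matrix.mulVec_mulVec, ← hφw, hφ]
    have h2 : A' ^ k * B' = (A ^ k * B).map (algebraMap ℝ ℂ) := by
      rw [Matrix.map_mul, hA', ← Matrix.map_pow]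
    rw [h2]
    ext j
    have := congrFun h1 j
    simp only [Matrix.vecMul, dotProduct, Pi.zero_apply, Matrix.map_apply] at this ⊢
    simpa using congrArg Complex.ofReal this
  rw [hW, Submodule.mem_bot] at hw
  ext i
  have := congrFun hw i
  simpa [w] using this

/-! ### Matchings -/

/-- Every matching can be turned into a maximum matching that still covers all the right vertices
covered by the given one. -/
theorem IsMatching.exists_maximum {n : ℕ} {A : StructMatrix n n} {M : Finset (Fin n × Fin n)}
    (hM : IsMatching A M) :
    ∃ N, IsMaximumMatching A N ∧ ∀ e ∈ M, ∃ f ∈ N, f.2 = e.2 := by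
  classical
  obtain ⟨N₀, hN₀⟩ : ∃ N, IsMaximumMatching A N := by
    obtain ⟨N, hN, hmax⟩ := Set.exists_max_image {N | IsMatching A N} Finset.card
      (Set.toFinite _) ⟨M, hM⟩
    exact ⟨N, hN, hmax⟩
  -- Among maximum matchings, take one sharing most edges with `M`. If the right end of `e` is
  -- uncovered, either `e` replaces the edge of `N` at its left end, increasing the overlap, or `e`
  -- can simply be added, increasing the size.
  obtain ⟨N, hN, hmax⟩ := Set.exists_max_image {N | IsMaximumMatching A N}
    (fun N => (N ∩ M).card) (Set.toFinite _) ⟨N₀, hN₀⟩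
  refine ⟨N, hN, fun e he => ?_⟩
  by_contra! hun
  have heN : e ∉ N := fun h => hun e h rfl
  by_cases hj : ∃ g ∈ N, g.1 = e.1
  · obtain ⟨g, hg, hge⟩ := hj
    have hgM : g ∉ M := fun h =>
      (hM.2 g h e he (fun h' => heN (h' ▸ hg))).1 hge
    have hnot : e ∉ N.erase g := fun h => heN (Finset.mem_of_mem_erase h)
    have hcard : (insert e (N.erase g)).card = N.card := by
      rw [Finset.card_insert_of_notMem hnot, Finset.card_erase_add_one hg]
    have hmatch : IsMatching A (insert e (N.erase g)) := by
      refine ⟨fun f hf => ?_, ?_⟩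
      · rcases Finset.mem_insert.1 hf with rfl | hf
        · exact hM.1 _ he
        · exact hN.1.1 _ (Finset.mem_of_mem_erase hf)
      · have key : ∀ f ∈ N.erase g, f.1 ≠ e.1 ∧ f.2 ≠ e.2 := fun f hf => by
          obtain ⟨hfg, hfN⟩ := Finset.mem_erase.1 hf
          exact ⟨hge ▸ (hN.1.2 f hfN g hg hfg).1, hun f hfN⟩
        intro f hf f' hf' hne
        rcases Finset.mem_insert.1 hf with rfl | h1 <;>
          rcases Finset.mem_insert.1 hf' with rfl | h2
        · exact absurd rfl hne
        · exact ⟨(key _ h2).1.symm, (key _ h2).2.symm⟩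
        · exact key _ h1
        · exact hN.1.2 f (Finset.mem_of_mem_erase h1) f' (Finset.mem_of_mem_erase h2) hne
    have h1 := hmax _ ⟨hmatch, fun K hK => hcard ▸ hN.2 K hK⟩
    have h2 : insert e (N ∩ M) ⊆ insert e (N.erase g) ∩ M := by
      intro f hf
      rcases Finset.mem_insert.1 hf with rfl | hf
      · exact Finset.mem_inter.2 ⟨Finset.mem_insert_self _ _, he⟩
      · obtain ⟨hfN, hfM⟩ := Finset.mem_inter.1 hf
        exact Finset.mem_inter.2 ⟨Finset.mem_insert_of_mem
          (Finset.mem_erase.2 ⟨fun h => hgM (h ▸ hfM), hfN⟩), hfM⟩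
    have h3 := Finset.card_le_card h2
    rw [Finset.card_insert_of_notMem fun h => heN (Finset.mem_inter.1 h).1] at h3
    exact absurd (h3.trans h1) (by simp)
  · push Not at hj
    have hmatch : IsMatching A (insert e N) := by
      refine ⟨fun f hf => ?_, fun f hf f' hf' hne => ?_⟩
      · rcases Finset.mem_insert.1 hf with rfl | hf
        · exact hM.1 _ he
        · exact hN.1.1 _ hf
      · rcases Finset.mem_insert.1 hf with rfl | h1 <;>
          rcases Finset.mem_insert.1 hf' with rfl | h2
        · exact absurd rfl hne
        · exact ⟨(hj _ h2).symm, (hun _ h2).symm⟩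
        · exact ⟨hj _ h1, hun _ h1⟩
        · exact hN.1.2 f h1 f' h2 hne
    have := hN.2 _ hmatch
    rw [Finset.card_insert_of_notMem heN] at this
    omega

/-- The graph of an injective choice of in-neighbours of the states in `D` extends, up to the choice
of left vertices, to a maximum matching covering the right copies of `D`. -/
theorem exists_maximumMatching_of_injOn {n : ℕ} {A : StructMatrix n n} {D : Set (Fin n)}
    {f : Fin n → Fin n} (hf : Set.InjOn f D) (hA : ∀ i ∈ D, A i (f i)) :
    ∃ M, IsMaximumMatching A M ∧ ∀ i ∈ D, ¬ RightUnmatched M i := by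
  classical
  let M₀ : Finset (Fin n × Fin n) := (Finset.univ.filter (· ∈ D)).image fun i => (f i, i)
  have hM₀ : ∀ e, e ∈ M₀ ↔ e.2 ∈ D ∧ f e.2 = e.1 := by
    rintro ⟨j, i⟩
    simp only [M₀, Finset.mem_image, Finset.mem_filter, Finset.mem_univ, true_and, Prod.mk.injEq]
    constructor
    · rintro ⟨_, hi, rfl, rfl⟩
      exact ⟨hi, rfl⟩
    · rintro ⟨hi, rfl⟩
      exact ⟨i, hi, rfl, rfl⟩
  have hmatch : IsMatching A M₀ := by
    refine ⟨fun e he => ?_, fun e he e' he' hne => ?_⟩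
    · rw [hM₀] at he
      exact he.2 ▸ hA _ he.1
    · rw [hM₀] at he he'
      have h2 : e.2 ≠ e'.2 := fun h => hne (Prod.ext (by rw [← he.2, ← he'.2, h]) h)
      exact ⟨fun h => h2 (hf he.1 he'.1 (by rw [he.2, he'.2, h])), h2⟩
  obtain ⟨N, hN, hcov⟩ := hmatch.exists_maximum
  refine ⟨N, hN, fun i hi hun => ?_⟩
  obtain ⟨e, he, hei⟩ := hcov (f i, i) ((hM₀ _).2 ⟨hi, rfl⟩)
  exact hun e he hei

/-- A matching covering the right copies of `D` extends to a permutation of the states. -/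
theorem IsMatching.exists_perm {n : ℕ} {A : StructMatrix n n} {M : Finset (Fin n × Fin n)}
    (hM : IsMatching A M) {D : Set (Fin n)} (hD : ∀ i ∈ D, ¬ RightUnmatched M i) :
    ∃ σ : Equiv.Perm (Fin n), ∀ i ∈ D, A i (σ i) := by
  classical
  have h1 : ∀ i : {i // i ∈ D}, ∃ j, (j, i.1) ∈ M := by
    rintro ⟨i, hi⟩
    have := hD i hi
    simp only [RightUnmatched] at this
    push Not at this
    obtain ⟨⟨j, _⟩, he, rfl⟩ := this
    exact ⟨j, he⟩
  choose f hf using h1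
  have hinj : Function.Injective f := fun i i' h => by
    by_contra hne
    exact (hM.2 _ (hf i) _ (hf i') fun h' => hne (Subtype.ext (congrArg Prod.snd h'))).1 h
  refine ⟨Equiv.extendSubtype (p := (· ∈ D)) (q := (· ∈ Set.range f))
    (Equiv.ofInjective f hinj), fun i hi => ?_⟩
  rw [Equiv.extendSubtype_apply_of_mem _ i hi]
  exact hM.1 _ (hf ⟨i, hi⟩)

/-! ### Strongly connected components -/

/-- If every non-top-linked component has a vertex outside `D`, then every vertex can be reached
from outside `D`. -/
theorem exists_reflTransGen_of_nonTopLinkedSCC {V : Type*} [Finite V] (G : Digraph V) (D : Set V)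
    (h : ∀ S, IsNonTopLinkedSCC G S → ¬ S ⊆ D) (v : V) :
    ∃ u, u ∉ D ∧ Relation.ReflTransGen G.Adj u v := by
  by_contra! hv
  let anc : V → Set V := fun x => {y | Relation.ReflTransGen G.Adj y x}
  -- An ancestor of `v` with fewest ancestors: minimality makes `anc u` strongly connected, and it
  -- is closed under predecessors, hence a non-top-linked SCC.
  obtain ⟨u, hu, hmin⟩ := Set.exists_min_image (anc v) (fun x => (anc x).ncard)
    (Set.toFinite _) ⟨v, .refl⟩
  have hback : ∀ w ∈ anc u, u ∈ anc w := fun w hw => by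
    have hsub : anc w ⊆ anc u := fun y hy => Relation.ReflTransGen.trans hy hw
    rw [Set.eq_of_subset_of_ncard_le hsub (hmin w (Relation.ReflTransGen.trans hw hu))
      (Set.toFinite _)]
    exact .refl
  have hpath : ∀ a b, Relation.ReflTransGen G.Adj a b → b ∈ anc u →
      Relation.ReflTransGen (fun a b => a ∈ anc u ∧ b ∈ anc u ∧ G.Adj a b) a b := by
    intro a b hab hb
    induction hab with
    | refl => exact .refl
    | tail _ hcb ih =>
      have hc := Relation.ReflTransGen.head hcb hb
      exact (ih hc).tail ⟨hc, hb, hcb⟩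
  refine h (anc u) ⟨⟨⟨⟨u, .refl⟩, fun a ha b hb => ?_⟩, fun T hT hle t ht => ?_⟩, ?_⟩ ?_
  · exact hpath a b (Relation.ReflTransGen.trans ha (hback b hb)) hb
  · have huT : u ∈ T := hle (.refl : Relation.ReflTransGen G.Adj u u)
    exact Relation.ReflTransGen.mono (fun _ _ h => h.2.2) _ _ (hT.2 t ht u huT)
  · exact fun a b ha hb hab => ha (Relation.ReflTransGen.head hab hb)
  · intro y hy
    by_contra hyD
    exact hv y hyD (Relation.ReflTransGen.trans hy hu)

/-- Reachability from a set gives a distance function which drops along some incoming edge. -/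
theorem exists_dist_of_reflTransGen {V : Type*} {r : V → V → Prop} {E : Set V}
    (h : ∀ v, ∃ u ∈ E, Relation.ReflTransGen r u v) :
    ∃ dist : V → ℕ, ∀ v, (dist v = 0 → v ∈ E) ∧
      (dist v ≠ 0 → ∃ u, r u v ∧ dist u < dist v) := by
  classical
  -- `R k v` says that a walk of length exactly `k` leads from `E` to `v`; the distance is the least
  -- such `k`.
  let R : ℕ → V → Prop := fun k =>
    Nat.rec (motive := fun _ => V → Prop) (· ∈ E) (fun _ P v => ∃ u, r u v ∧ P u) k
  have hex : ∀ v, ∃ k : ℕ, R k v := fun v => by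
    obtain ⟨u, hu, huv⟩ := h v
    induction huv with
    | refl => exact ⟨0, hu⟩
    | tail _ hab ih =>
      obtain ⟨k, hk⟩ := ih
      exact ⟨k + 1, _, hab, hk⟩
  have hdec : ∀ v, DecidablePred fun k => R k v := fun v k => Classical.propDecidable _
  refine ⟨fun v => Nat.find (p := fun k => R k v) (hex v), fun v => ⟨fun h0 => ?_, fun h0 => ?_⟩⟩
  · have := Nat.find_spec (hex v)
    have h0 : Nat.find (p := fun k => R k v) (hex v) = 0 := h0
    rwa [h0] at this
  · obtain ⟨k, hk⟩ := Nat.exists_eq_succ_of_ne_zero h0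
    have := Nat.find_spec (hex v)
    have hk : Nat.find (p := fun k => R k v) (hex v) = k + 1 := hk
    rw [hk] at this
    obtain ⟨u, huv, hu⟩ := this
    refine ⟨u, huv, ?_⟩
    have := Nat.find_min' (p := fun k => R k u) (hex u) hu
    change Nat.find (p := fun k => R k u) (hex u) < Nat.find (p := fun k => R k v) (hex v)
    omega

/-! ### Necessary conditions for structural controllability -/

/-- A controllable realization provides distinct in-neighbours for the states without an input. -/
theorem exists_injOn_of_controllable {n p : ℕ} {A : StructMatrix n n} {B : StructMatrix n p}
    (h : StructurallyControllable A B) {D : Set (Fin n)} (hD : Disjoint D (inputStates B)) :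
    ∃ f : Fin n → Fin n, Set.InjOn f D ∧ ∀ i ∈ D, A i (f i) := by
  classical
  obtain ⟨A', B', hA, hB, hc⟩ := h
  let V : Submodule ℝ (Fin n → ℝ) := A'.mulVecLin.range ⊔ B'.mulVecLin.range
  have hV : V = ⊤ := hc.eq_top_of_invariant V
    (fun x _ => Submodule.mem_sup_left ⟨x, rfl⟩) (fun u => Submodule.mem_sup_right ⟨u, rfl⟩)
  let t : {i // i ∈ D} → Finset (Fin n) := fun i => Finset.univ.filter fun j => A i.1 j
  have hall : ∀ s : Finset {i // i ∈ D}, s.card ≤ (s.biUnion t).card := by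
    intro s
    -- Rows in `s`, columns in their possible in-neighbours. Since `B'` vanishes on these rows, `C`
    -- is surjective, which is Hall's inequality for `s`.
    let C : Matrix s (s.biUnion t) ℝ := Matrix.of fun i j => A' i.1.1 j.1
    have hsurj : Function.Surjective C.mulVecLin := by
      intro y
      have hinj : Function.Injective fun i : s => i.1.1 :=
        Subtype.val_injective.comp Subtype.val_injective
      obtain ⟨_, ⟨x, rfl⟩, _, ⟨u, rfl⟩, hxu⟩ := Submodule.mem_sup.1
        (hV ▸ Submodule.mem_top : Function.extend (fun i : s => i.1.1) y 0 ∈ V)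
      refine ⟨fun j => x j.1, funext fun i => ?_⟩
      have hi := congrFun hxu i.1.1
      rw [hinj.extend_apply y 0 i] at hi
      rw [← hi]
      have hBu : (B' *ᵥ u) i.1.1 = 0 := by
        change ∑ k, B' i.1.1 k * u k = 0
        refine Finset.sum_eq_zero fun k _ => ?_
        rw [hB _ _ fun hk => Set.disjoint_left.1 hD i.1.2 ⟨k, hk⟩, zero_mul]
      simp only [Pi.add_apply, Matrix.mulVecLin_apply, hBu, add_zero]
      simp only [Matrix.mulVec, dotProduct, C, Matrix.of_apply]
      rw [Finset.sum_coe_sort (s.biUnion t) fun j => A' i.1.1 j * x j]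
      refine Finset.sum_subset (Finset.subset_univ _) fun j _ hj => ?_
      rw [hA _ _ fun hij => hj (Finset.mem_biUnion.2 ⟨i.1, i.2, by simpa [t] using hij⟩), zero_mul]
    have := LinearMap.finrank_le_finrank_of_surjective hsurj
    rwa [Module.finrank_fintype_fun_eq_card, Module.finrank_fintype_fun_eq_card,
      Fintype.card_coe, Fintype.card_coe] at this
  obtain ⟨f, hf, hft⟩ := (Finset.all_card_le_biUnion_card_iff_exists_injective t).1 hall
  refine ⟨fun i => if hi : i ∈ D then f ⟨i, hi⟩ else i, fun i hi j hj hij => ?_, fun i hi => ?_⟩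
  · simp only [dif_pos hi, dif_pos hj] at hij
    exact congrArg Subtype.val (hf hij)
  · simpa [hi, t] using hft ⟨i, hi⟩

/-- Every non-top-linked component of a structurally controllable pair has an input. -/
theorem not_subset_of_isNonTopLinkedSCC {n p : ℕ} {A : StructMatrix n n} {B : StructMatrix n p}
    (h : StructurallyControllable A B) {D : Set (Fin n)} (hD : Disjoint D (inputStates B))
    {S : Set (Fin n)} (hS : IsNonTopLinkedSCC (digraph A) S) : ¬ S ⊆ D := by
  intro hSD
  obtain ⟨A', B', hA, hB, hc⟩ := h
  let V : Submodule ℝ (Fin n → ℝ) :=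
    { carrier := {x | ∀ i ∈ S, x i = 0}
      zero_mem' := fun _ _ => rfl
      add_mem' := fun hx hy i hi => by rw [Pi.add_apply, hx i hi, hy i hi, add_zero]
      smul_mem' := fun c x hx i hi => by rw [Pi.smul_apply, hx i hi, smul_zero] }
  have hV : V = ⊤ := by
    refine hc.eq_top_of_invariant V (fun x hx i hi => ?_) (fun u i hi => ?_)
    · change ∑ j, A' i j * x j = 0
      refine Finset.sum_eq_zero fun j _ => ?_
      by_cases hj : j ∈ S
      · rw [hx j hj, mul_zero]
      · rw [hA i j (hS.2 j i hj hi), zero_mul]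
    · change ∑ k, B' i k * u k = 0
      refine Finset.sum_eq_zero fun k _ => ?_
      rw [hB _ _ fun hk => Set.disjoint_left.1 hD (hSD hi) ⟨k, hk⟩, zero_mul]
  obtain ⟨i, hi⟩ := hS.1.1.1
  have h1 : (fun _ => 1 : Fin n → ℝ) ∈ V := hV ▸ Submodule.mem_top
  exact one_ne_zero (h1 i hi)

/-! ### Eigenvectors along a permutation -/

section Eigenvector

variable {n : ℕ} {σ : Equiv.Perm (Fin n)} {μ : ℂ} {w : Fin n → ℂ}

/-- On a cycle of weight `c` without further terms, an eigenvector that is not zero vanishes nowhere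
and its eigenvalue has absolute value `c`. -/
theorem norm_eq_and_ne_zero_of_cycle {c : ℝ} (hc : 0 < c) {i₀ : Fin n}
    (heq : ∀ i, σ.SameCycle i₀ i → μ * w (σ i) = c * w i) (h0 : w i₀ ≠ 0) :
    ‖μ‖ = c ∧ ∀ j, σ.SameCycle i₀ j → w j ≠ 0 := by
  have hpow : ∀ k : ℕ, μ ^ k * w ((σ ^ k) i₀) = (c : ℂ) ^ k * w i₀ := by
    intro k
    induction k with
    | zero => simp
    | succ k ih =>
      have := heq ((σ ^ k) i₀) (Equiv.Perm.sameCycle_pow_right.2 (Equiv.Perm.SameCycle.refl σ i₀))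
      rw [pow_succ' σ, Equiv.Perm.mul_apply, pow_succ, mul_assoc, this, mul_left_comm, ih]
      ring
  have hc' : (c : ℂ) ≠ 0 := by exact_mod_cast hc.ne'
  refine ⟨?_, fun j hj hw => ?_⟩
  -- After `orderOf σ` steps the walk is back at `i₀`, so `μ` and `c` have equal powers.
  · have h := hpow (orderOf σ)
    rw [pow_orderOf_eq_one, Equiv.Perm.one_apply] at h
    have h := congrArg norm (mul_right_cancel₀ h0 h)
    rw [norm_pow, norm_pow, Complex.norm_real, Real.norm_of_nonneg hc.le] at h
    exact (pow_left_inj₀ (norm_nonneg _) hc.le (orderOf_pos σ).ne').1 h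
  · obtain ⟨k, -, rfl⟩ := hj.exists_pow_eq'
    have := hpow k
    rw [hw, mul_zero] at this
    exact mul_ne_zero (pow_ne_zero _ hc') h0 this.symm

/-- On a cycle with one nonzero additional term, an eigenvector vanishes nowhere. -/
theorem ne_zero_of_cycle_of_link {c a : ℂ} (hc : c ≠ 0) (hμ : μ ≠ 0) (ha : a ≠ 0) {l : Fin n}
    (heq : ∀ i, σ.SameCycle l i → μ * w (σ i) = c * w i + if l = σ i then a else 0) :
    ∀ j, σ.SameCycle l j → w j ≠ 0 := by
  have hs : ∀ k : ℕ, σ.SameCycle l ((σ ^ k) l) := fun k =>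
    Equiv.Perm.sameCycle_pow_right.2 (Equiv.Perm.SameCycle.refl σ l)
  -- A zero propagates backwards along the cycle to `l` because `c ≠ 0`, then forwards from `l`
  -- because `μ ≠ 0`; the equation entering `l` would then read `0 = a`.
  have hback : ∀ k : ℕ, w ((σ ^ k) l) = 0 → w l = 0 := by
    intro k
    induction k with
    | zero => exact fun h => h
    | succ k ih =>
      intro h
      rw [pow_succ', Equiv.Perm.mul_apply] at h
      by_cases hl : l = σ ((σ ^ k) l)
      · rwa [← hl] at h
      · have := heq _ (hs k)
        rw [h, if_neg hl, mul_zero, add_zero] at this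
        exact ih ((mul_eq_zero.1 this.symm).resolve_left hc)
  rintro j hj hwj
  obtain ⟨k, -, rfl⟩ := hj.exists_pow_eq'
  have hl := hback k hwj
  have hall : ∀ k : ℕ, w ((σ ^ k) l) = 0 := by
    intro k
    induction k with
    | zero => exact hl
    | succ k ih =>
      rw [pow_succ', Equiv.Perm.mul_apply]
      by_cases h : l = σ ((σ ^ k) l)
      · rwa [← h]
      · have := heq _ (hs k)
        rw [ih, if_neg h, mul_zero, add_zero] at this
        exact (mul_eq_zero.1 this).resolve_left hμ
  obtain ⟨m, -, hm⟩ := (Equiv.Perm.sameCycle_symm_apply_right.2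
    (Equiv.Perm.SameCycle.refl σ l)).exists_pow_eq'
  have := heq ((σ ^ m) l) (hs m)
  rw [hall m, hm, Equiv.apply_symm_apply, hl, if_pos rfl, mul_zero, mul_zero, zero_add] at this
  exact ha this.symm

/-- The cycles of `σ`, represented by the values of `L`, form a forest in which the parent of the
cycle of `r` is the cycle of `p r`, and every root meets the complement of `D`. If the cycles have
distinct weights, then no eigenvector vanishes off `D`. -/
theorem eq_zero_of_cycle_forest {D : Set (Fin n)} {L p : Fin n → Fin n} {dist : Fin n → ℕ}
    (hL : ∀ i j, L i = L j ↔ σ.SameCycle i j) (hLL : ∀ i, L (L i) = L i)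
    (hmin : ∀ i, dist (L i) ≤ dist i) (hp : ∀ i, dist i ≠ 0 → dist (p i) < dist i)
    (hroot : ∀ i, dist i = 0 → i ∉ D) (hw : ∀ i, i ∉ D → w i = 0)
    (heq : ∀ i, μ * w (σ i) = ((L i : ℕ) + 1 : ℝ) * w i +
      ∑ r, if L r = r ∧ dist r ≠ 0 ∧ p r = σ i then w r else 0) : w = 0 := by
  classical
  by_contra hne
  have hLσ : ∀ i, L (σ i) = L i := fun i => (hL _ _).2
    (Equiv.Perm.sameCycle_apply_left.2 (Equiv.Perm.SameCycle.refl σ i))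
  have hdp : ∀ r, dist r ≠ 0 → dist (L (p r)) < dist r := fun r hr =>
    (hmin _).trans_lt (hp r hr)
  -- a cycle all of whose children vanish
  have hleaf : ∀ q, (∀ r, L r = r → dist r ≠ 0 → L (p r) = q → w r = 0) →
      ∀ i, L i = q → w i ≠ 0 → ‖μ‖ = (q : ℕ) + 1 ∧ ∀ j, L j = q → w j ≠ 0 := by
    rintro q hq i rfl hi
    obtain ⟨h1, h2⟩ := norm_eq_and_ne_zero_of_cycle (σ := σ) (c := (L i : ℕ) + 1) (by positivity)
      (fun j hj => by
        rw [heq j, Finset.sum_eq_zero, add_zero, (hL _ _).2 hj]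
        intro r _
        refine ite_eq_right_iff.2 fun ⟨hr, hd, hpr⟩ => hq r hr hd ?_
        rw [hpr, hLσ, (hL _ _).2 hj]) hi
    exact ⟨h1, fun j hj => h2 j ((hL _ _).1 hj.symm)⟩
  -- a cycle with exactly one child that does not vanish
  have hlink : μ ≠ 0 → ∀ r, L r = r → dist r ≠ 0 → w r ≠ 0 →
      (∀ r', L r' = r' → dist r' ≠ 0 → L (p r') = L (p r) → r' ≠ r → w r' = 0) →
      ∀ j, L j = L (p r) → w j ≠ 0 := by
    intro hμ r hr hd hwr hothers j hj
    refine ne_zero_of_cycle_of_link (σ := σ) (l := p r) (c := ((L (p r) : ℕ) + 1 : ℝ)) (a := w r)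
      ?_ hμ hwr (fun i hi => ?_) j ((hL _ _).1 hj.symm)
    · exact_mod_cast Nat.succ_ne_zero (L (p r))
    · rw [heq i, (hL _ _).2 hi, Finset.sum_eq_single r]
      · simp [hr, hd]
      · intro r' _ hne'
        refine ite_eq_right_iff.2 fun ⟨hr', hd', hpr⟩ => hothers r' hr' hd' ?_ hne'
        rw [hpr, hLσ, (hL _ _).2 hi]
      · simp
  -- the nonzero cycle furthest from the roots
  obtain ⟨q₀, ⟨hq₀, i₀, hi₀, hwi₀⟩, hmax⟩ := Set.exists_max_image
    {q | L q = q ∧ ∃ i, L i = q ∧ w i ≠ 0} dist (Set.toFinite _) (by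
      obtain ⟨i, hi⟩ := Function.ne_iff.1 hne
      exact ⟨L i, hLL i, i, rfl, hi⟩)
  obtain ⟨hμ, hnz₀⟩ := hleaf q₀ (fun r hr hd hpr => by
    by_contra hwr
    have h1 := hmax r ⟨hr, r, hr, hwr⟩
    have h2 := hdp r hd
    rw [hpr] at h2
    omega) i₀ hi₀ hwi₀
  have hμ0 : μ ≠ 0 := norm_ne_zero_iff.1 (by rw [hμ]; positivity)
  -- Roots are their own parents, so the iterates of `par` stay at the root once it is reached.
  let par : Fin n → Fin n := fun r => if dist r = 0 then r else L (p r)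
  have hparL : ∀ k, L (par^[k] q₀) = par^[k] q₀ := by
    intro k
    induction k with
    | zero => exact hq₀
    | succ k ih =>
      rw [Function.iterate_succ_apply']
      by_cases h : dist (par^[k] q₀) = 0
      · simp only [par, if_pos h, ih]
      · simp only [par, if_neg h, hLL]
  have hpar_le : ∀ r, dist (par r) ≤ dist r := fun r => by
    by_cases h : dist r = 0
    · simp only [par, if_pos h, le_refl]
    · simpa only [par, if_neg h] using (hdp r h).le
  have hiter_le : ∀ k r, dist (par^[k] r) ≤ dist r := by
    intro k r
    induction k with
    | zero => exact le_rfl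
    | succ k ih =>
      rw [Function.iterate_succ_apply']
      exact (hpar_le _).trans ih
  -- cycles that are not ancestors of `q₀` vanish
  have hoff : ∀ q, L q = q → (∀ k, q ≠ par^[k] q₀) → ∀ i, L i = q → w i = 0 := by
    by_contra! hbad
    obtain ⟨q, ⟨hq, hqk, i, hi, hwi⟩, hqmax⟩ := Set.exists_max_image
      {q | L q = q ∧ (∀ k, q ≠ par^[k] q₀) ∧ ∃ i, L i = q ∧ w i ≠ 0} dist (Set.toFinite _) hbad
    -- A child of a non-ancestor of `q₀` is again a non-ancestor, so the children of the deepest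
    -- such `q` vanish. Then `‖μ‖` is the weight of both `q` and `q₀`, whence `q = q₀`.
    obtain ⟨hμq, -⟩ := hleaf q (fun r hr hd hpr => by
      by_contra hwr
      have h1 := hqmax r ⟨hr, fun k hk => hqk (k + 1) ?_, r, hr, hwr⟩
      · have h2 := hdp r hd
        rw [hpr] at h2
        omega
      · rw [Function.iterate_succ_apply', ← hk]
        simp only [par, if_neg hd, hpr]) i hi hwi
    refine hqk 0 (Fin.ext ?_)
    have : ((q : ℕ) : ℝ) = (q₀ : ℕ) := by linarith
    exact_mod_cast this
  -- along the ancestors of `q₀` the eigenvector vanishes nowhere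
  have hchain : ∀ k, ∀ j, L j = par^[k] q₀ → w j ≠ 0 := by
    intro k
    induction k with
    | zero => exact hnz₀
    | succ k ih =>
      rw [Function.iterate_succ_apply']
      by_cases h : dist (par^[k] q₀) = 0
      · simpa only [par, if_pos h] using ih
      · have hpk : par (par^[k] q₀) = L (p (par^[k] q₀)) := by simp only [par, if_neg h]
        rw [hpk]
        refine hlink hμ0 _ (hparL k) h (ih _ (hparL k)) fun r hr hd hpr hne' => ?_
        refine hoff r hr (fun m hm => ?_) r hr
        have hpr' : par r = par (par^[k] q₀) := by rw [hpk, ← hpr]; simp only [par, if_neg hd]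
        have hlt : dist (par r) < dist r := by simpa only [par, if_neg hd] using hdp r hd
        have hlt' : dist (par (par^[k] q₀)) < dist (par^[k] q₀) := by
          simpa only [par, if_neg h] using hdp _ h
        -- Two members of the branch with the same parent coincide: otherwise the later one would be
        -- an iterated parent of that common parent, while lying strictly deeper.
        rcases lt_trichotomy m k with hmk | hmk | hmk
        · obtain ⟨d, rfl⟩ := Nat.exists_eq_add_of_lt hmk
          have : par^[m + d + 1] q₀ = par^[d] (par r) := by
            rw [hm, ← Function.iterate_succ_apply' par m, ← Function.iterate_add_apply,
              show d + m.succ = m + d + 1 by omega]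
          have h3 := hiter_le d (par r)
          rw [← this, hpr'] at h3
          omega
        · exact hne' (hmk ▸ hm)
        · obtain ⟨d, rfl⟩ := Nat.exists_eq_add_of_lt hmk
          have : r = par^[d] (par (par^[k] q₀)) := by
            rw [hm, ← Function.iterate_succ_apply' par k, ← Function.iterate_add_apply,
              show d + k.succ = k + d + 1 by omega]
          have h3 := hiter_le d (par (par^[k] q₀))
          rw [← this, ← hpr'] at h3
          omega
  have hdist : ∀ k, dist (par^[k] q₀) = 0 ∨ dist (par^[k] q₀) + k ≤ dist q₀ := by
    intro k
    induction k with
    | zero => exact Or.inr le_rfl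
    | succ k ih =>
      rw [Function.iterate_succ_apply']
      by_cases h : dist (par^[k] q₀) = 0
      · exact Or.inl (by simpa only [par, if_pos h] using h)
      · have hlt := hdp _ h
        have : par (par^[k] q₀) = L (p (par^[k] q₀)) := by simp only [par, if_neg h]
        rw [this]
        omega
  have hend : dist (par^[dist q₀] q₀) = 0 := by
    have := hdist (dist q₀)
    omega
  exact hchain _ _ (hparL _) (hw _ (hroot _ hend))

end Eigenvector

/-! ### A controllable realization -/

/-- If the states in `D` have distinct in-neighbours and all states can be reached from the
complement of `D`, then one input at each state outside `D` achieves structural controllability. -/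
theorem structurallyControllable_of_perm {n : ℕ} {A : StructMatrix n n} {D : Set (Fin n)}
    {σ : Equiv.Perm (Fin n)} (hσ : ∀ i ∈ D, A i (σ i)) {dist : Fin n → ℕ}
    (hdist : ∀ v, (dist v = 0 → v ∈ Dᶜ) ∧ (dist v ≠ 0 → ∃ u, A v u ∧ dist u < dist v)) :
    StructurallyControllable A (fun i j => i = j ∧ i ∉ D : StructMatrix n n) := by
  classical
  have hp : ∀ v, ∃ u, dist v ≠ 0 → A v u ∧ dist u < dist v := fun v => by
    by_cases h : dist v = 0
    · exact ⟨v, fun h' => absurd h h'⟩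
    · obtain ⟨u, hu⟩ := (hdist v).2 h
      exact ⟨u, fun _ => hu⟩
  choose p hp using hp
  -- Representatives nearest to the complement of `D` make the distance of the representative drop
  -- strictly from a cycle to its parent.
  have hmin : ∀ c : Quotient (Equiv.Perm.SameCycle.setoid σ),
      ∃ i, Quotient.mk _ i = c ∧ ∀ j, Quotient.mk _ j = c → dist i ≤ dist j := fun c => by
    obtain ⟨i, hi, h⟩ := Set.exists_min_image {i | Quotient.mk _ i = c} dist (Set.toFinite _)
      (Quotient.exists_rep c)
    exact ⟨i, hi, h⟩
  choose rep hrep hrepmin using hmin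
  let L : Fin n → Fin n := fun i => rep (Quotient.mk _ i)
  have hL : ∀ i j, L i = L j ↔ σ.SameCycle i j := fun i j => by
    constructor
    · intro h
      have := congrArg (Quotient.mk (Equiv.Perm.SameCycle.setoid σ)) h
      simp only [L, hrep] at this
      exact Quotient.exact this
    · intro h
      exact congrArg rep (Quotient.sound h)
  -- The `+ 1` keeps the weight positive for index `0`. Rows outside `D` carry no cycle entry, since
  -- `A i (σ i)` may fail there; the eigenvector equation is unaffected because `w i = 0`.
  let A' : Matrix (Fin n) (Fin n) ℝ := Matrix.of fun i j =>
    (if i ∈ D ∧ σ i = j then ((L i : ℕ) + 1 : ℝ) else 0) +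
      if L i = i ∧ dist i ≠ 0 ∧ p i = j then 1 else 0
  let B' : Matrix (Fin n) (Fin n) ℝ := Matrix.of fun i j => if i = j ∧ i ∉ D then 1 else 0
  refine ⟨A', B', fun i j hij => ?_, fun i j hij => ?_,
    controllable_of_hautus _ _ fun μ w hA hB => ?_⟩
  · simp only [A', Matrix.of_apply]
    rw [if_neg, if_neg, add_zero]
    · rintro ⟨-, hd, rfl⟩
      exact hij (hp i hd).1
    · rintro ⟨hi, rfl⟩
      exact hij (hσ i hi)
  · simp only [B', Matrix.of_apply]
    exact if_neg hij
  · have hw : ∀ i, i ∉ D → w i = 0 := fun i hi => by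
      have := congrFun hB i
      simp only [Matrix.vecMul, dotProduct, Matrix.map_apply, B', Matrix.of_apply] at this
      rw [Finset.sum_eq_single i] at this
      · simpa [hi] using this
      · intro j _ hj
        simp [hj]
      · simp
    refine eq_zero_of_cycle_forest (σ := σ) (μ := μ) (D := D) (L := L) (p := p) (dist := dist) hL
      (fun i => by simp only [L, hrep]) (fun i => hrepmin _ i rfl) (fun i hi => (hp i hi).2)
      (fun i hi => (hdist i).1 hi) hw fun i => ?_
    have := congrFun hA (σ i)
    rw [Pi.smul_apply, smul_eq_mul] at this
    rw [← this]
    simp only [Matrix.vecMul, dotProduct, Matrix.map_apply, A', Matrix.of_apply, map_add, mul_add,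
      Finset.sum_add_distrib]
    congr 1
    · rw [Finset.sum_eq_single i]
      · by_cases hi : i ∈ D
        · simp [hi, mul_comm]
        · simp [hw i hi]
      · intro j _ hj
        simp [hj]
      · simp
    · refine Finset.sum_congr rfl fun r _ => ?_
      split_ifs <;> simp

end StructuredSystem

theorem mainTheorem3 (n d : ℕ) (A : StructuredSystem.StructMatrix n n)
    (Bdef : StructuredSystem.StructMatrix n d) (Kdef : StructuredSystem.StructMatrix d n) :
    StructuredSystem.ResilientToIntegrityAttack A Bdef Kdef ↔
      ((∀ M : Finset (Fin n × Fin n),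
          StructuredSystem.IsMaximumMatching (StructuredSystem.closedLoop A Bdef Kdef) M →
            ∃ i ∈ StructuredSystem.inputStates Bdef, StructuredSystem.RightUnmatched M i) ∨
        ∃ S : Set (Fin n),
          StructuredSystem.IsNonTopLinkedSCC
              (StructuredSystem.digraph (StructuredSystem.closedLoop A Bdef Kdef)) S ∧
            S ⊆ StructuredSystem.inputStates Bdef) := by
  constructor
  · intro hres
    by_contra! hcon
    obtain ⟨⟨M, hM, hcov⟩, hscc⟩ := hcon
    obtain ⟨σ, hσ⟩ := hM.1.exists_perm hcov
    obtain ⟨dist, hdist⟩ := StructuredSystem.exists_dist_of_reflTransGen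
      (E := (StructuredSystem.inputStates Bdef)ᶜ)
      (StructuredSystem.exists_reflTransGen_of_nonTopLinkedSCC _ _ hscc)
    refine hres ⟨n, _, ?_, StructuredSystem.structurallyControllable_of_perm hσ hdist⟩
    rw [Set.disjoint_left]
    rintro i hi ⟨_, -, hi'⟩
    exact hi' hi
  · rintro h ⟨a, Batt, hdisj, hsc⟩
    rcases h with h | ⟨S, hS, hSD⟩
    · obtain ⟨f, hf, hfA⟩ := StructuredSystem.exists_injOn_of_controllable hsc hdisj
      obtain ⟨M, hM, hcov⟩ := StructuredSystem.exists_maximumMatching_of_injOn hf hfA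
      obtain ⟨i, hi, hun⟩ := h M hM
      exact hcov i hi hun
    · exact StructuredSystem.not_subset_of_isNonTopLinkedSCC hsc hdisj hS hSD
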